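/- A semigroup variety is a class of semigroups consisting of all semigroups that satisfy some given set of identities. Let $\mathbb{SEM}$ be the lattice of all semigroup varieties, ordered by inclusion. An element $x$ of a lattice $L$ is called cancellable if for all $y,z\in L$ the equalities $x\vee y=x\vee z$ and $x\wedge y=x\wedge z$ imply $y=z$. A permutational identity of length $n$ is an identity of the form $x_1x_2\cdots x_n\approx x_{\pi(1)}x_{\pi(2)}\cdots x_{\pi(n)}$, where $\pi$ is a non-trivial permutation of the set $\{1,2,\dots,n\}$. Let $\mathbf V$ be a cancellable element of the lattice $\mathbb{SEM}$ and let $n$ be a natural number. If $\mathbf V$ satisfies some permutational identity of length $n$, then $\mathbf V$ satisfies all permutational identities of length $n$. -/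

import Mathlib

universe u

/-- Semigroup words: elements of the free semigroup over a countably infinite alphabet,
whose letters `x₁, x₂, x₃, …` are indexed by the natural numbers `0, 1, 2, …`. -/
abbrev SemigroupWord : Type := FreeSemigroup ℕ

/-- The (nonempty) list of letters of a word, read from left to right. -/
def SemigroupWord.letters (w : SemigroupWord) : List ℕ := w.head :: w.tail

/-- A semigroup identity `lhs ≈ rhs`. -/
structure SemigroupIdentity : Type where
  lhs : SemigroupWord
  rhs : SemigroupWord

/-- The identity `e` holds in the semigroup `S`: both sides take the same value under every
substitution of elements of `S` for the letters. -/
def SemigroupIdentity.HoldsIn (e : SemigroupIdentity) (S : Type u) [Semigroup S] : Prop :=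
  ∀ f : ℕ → S, FreeSemigroup.lift f e.lhs = FreeSemigroup.lift f e.rhs

/-- The class of all (nonempty) semigroups in which all identities from `E` hold. -/
def semigroupModels (E : Set SemigroupIdentity) : Set Semigrp.{u} :=
  {S | Nonempty S ∧ ∀ e ∈ E, e.HoldsIn S}

/-- A semigroup variety: a class of semigroups that is the class of all models of some set
of identities. -/
@[ext]
structure SemigroupVariety : Type (u + 1) where
  carrier : Set Semigrp.{u}
  equational : ∃ E : Set SemigroupIdentity, carrier = semigroupModels E

namespace SemigroupVariety

/-- The variety satisfies the identity `e`: it holds in all of its members. -/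
def Satisfies (V : SemigroupVariety.{u}) (e : SemigroupIdentity) : Prop :=
  ∀ S ∈ V.carrier, e.HoldsIn S

/-- The variety defined by a set of identities. -/
def ofIdentities (E : Set SemigroupIdentity) : SemigroupVariety.{u} :=
  ⟨semigroupModels E, E, rfl⟩

/-- Varieties are ordered by inclusion of classes. -/
instance : PartialOrder SemigroupVariety.{u} :=
  PartialOrder.lift carrier fun _ _ h => SemigroupVariety.ext h

theorem le_iff {V W : SemigroupVariety.{u}} : V ≤ W ↔ V.carrier ⊆ W.carrier := Iff.rfl

/-- The lattice of all semigroup varieties. The meet is the intersection of classes; the join is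
the least variety containing both classes, that is, the class of all semigroups that satisfy
every identity common to the two varieties. -/
instance : Lattice SemigroupVariety.{u} where
  inf V W := ⟨V.carrier ∩ W.carrier, by
    obtain ⟨E, hE⟩ := V.equational
    obtain ⟨F, hF⟩ := W.equational
    refine ⟨E ∪ F, ?_⟩
    rw [hE, hF]
    ext S
    constructor
    · rintro ⟨⟨h, h1⟩, _, h2⟩
      exact ⟨h, fun e he => he.elim (h1 e) (h2 e)⟩
    · rintro ⟨h, h1⟩
      exact ⟨⟨h, fun e he => h1 e (Or.inl he)⟩, h, fun e he => h1 e (Or.inr he)⟩⟩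
  sup V W := ofIdentities {e | V.Satisfies e ∧ W.Satisfies e}
  inf_le_left _ _ := Set.inter_subset_left
  inf_le_right _ _ := Set.inter_subset_right
  le_inf _ _ _ h1 h2 := Set.subset_inter h1 h2
  le_sup_left V W := by
    intro S hS
    obtain ⟨E, hE⟩ := V.equational
    exact ⟨(hE ▸ hS : S ∈ semigroupModels E).1, fun e he => he.1 S hS⟩
  le_sup_right V W := by
    intro S hS
    obtain ⟨E, hE⟩ := W.equational
    exact ⟨(hE ▸ hS : S ∈ semigroupModels E).1, fun e he => he.2 S hS⟩
  sup_le V W U h1 h2 := by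
    intro S hS
    obtain ⟨E, hE⟩ := U.equational
    rw [hE]
    refine ⟨hS.1, fun e he => hS.2 e ⟨fun T hT => ?_, fun T hT => ?_⟩⟩
    · exact (hE ▸ h1 hT : T ∈ semigroupModels E).2 e he
    · exact (hE ▸ h2 hT : T ∈ semigroupModels E).2 e he

end SemigroupVariety

/-- Cancellable elements of a lattice. -/
def IsCancellableElement {L : Type*} [Lattice L] (x : L) : Prop :=
  ∀ y z : L, x ⊔ y = x ⊔ z → x ⊓ y = x ⊓ z → y = z

/-- `e` is a permutational identity of length `n`: it has the form
`x₁ x₂ ⋯ xₙ ≈ x_{π(1)} x_{π(2)} ⋯ x_{π(n)}` for a nontrivial permutation `π`. -/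
def IsPermutationalIdentity (n : ℕ) (e : SemigroupIdentity) : Prop :=
  ∃ π : Equiv.Perm (Fin n), π ≠ 1 ∧
    e.lhs.letters = List.ofFn (fun i : Fin n => (i : ℕ)) ∧
    e.rhs.letters = List.ofFn (fun i : Fin n => (π i : ℕ))

/-! ### Cancellable subgroups of symmetric groups -/

section SymmetricGroup

variable {α : Type*} [DecidableEq α]

/-! Let G ≤ S_n collect the permutations whose length-n identities hold in V. To H ≤ S_n attach the
variety X_H that identifies all long words and permutes positions in linear words of length n by H.
The map H ↦ X_H is injective. If H and K have equal joins with G, then X_H and X_K have equal meets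
with V, and dually. Hence V cancellable makes G cancellable among subgroups
(`isCancellableElement_permGroup`). For a transposition t ∉ G and g ∈ G, the groups ⟨t⟩ and ⟨gtg⁻¹⟩
have the same join with G and meet it trivially, so gtg⁻¹ = t. A nontrivial g ∈ G then forces every
transposition into G (`IsCancellableElement.eq_top_of_mem`). -/

theorem mem_zpowers_swap {x y : α} {σ : Equiv.Perm α} :
    σ ∈ Subgroup.zpowers (Equiv.swap x y) ↔ σ = 1 ∨ σ = Equiv.swap x y := by
  constructor
  · rintro ⟨k, rfl⟩
    rcases Int.even_or_odd' k with ⟨m, rfl | rfl⟩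
    · left
      simp [zpow_mul, sq]
    · right
      simp [zpow_add, zpow_mul, sq]
  · rintro (rfl | rfl)
    · exact one_mem _
    · exact Subgroup.mem_zpowers _

theorem inf_zpowers_swap {G : Subgroup (Equiv.Perm α)} {x y : α} (h : Equiv.swap x y ∉ G) :
    G ⊓ Subgroup.zpowers (Equiv.swap x y) = ⊥ := by
  rw [eq_bot_iff]
  rintro σ ⟨hG, hσ⟩
  rcases mem_zpowers_swap.1 hσ with rfl | rfl
  · exact one_mem _
  · exact absurd hG h

theorem sup_zpowers_conj_le {M : Type*} [Group M] {G : Subgroup M} {g : M} (hg : g ∈ G) (t : M) :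
    G ⊔ Subgroup.zpowers (g * t * g⁻¹) ≤ G ⊔ Subgroup.zpowers t := by
  have hg' : g ∈ G ⊔ Subgroup.zpowers t := Subgroup.mem_sup_left hg
  refine sup_le le_sup_left ((Subgroup.zpowers_le).2 ?_)
  exact mul_mem (mul_mem hg' (Subgroup.mem_sup_right (Subgroup.mem_zpowers t))) (inv_mem hg')

theorem sup_zpowers_conj {M : Type*} [Group M] {G : Subgroup M} {g : M} (hg : g ∈ G) (t : M) :
    G ⊔ Subgroup.zpowers (g * t * g⁻¹) = G ⊔ Subgroup.zpowers t := by
  refine le_antisymm (sup_zpowers_conj_le hg t) ?_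
  have := sup_zpowers_conj_le (inv_mem hg) (g * t * g⁻¹)
  simpa [mul_assoc] using this

/-- A cancellable subgroup of a symmetric group centralizes every transposition outside it. -/
theorem IsCancellableElement.swap_apply {G : Subgroup (Equiv.Perm α)}
    (hG : IsCancellableElement G) {x y : α} (h : Equiv.swap x y ∉ G) {g : Equiv.Perm α}
    (hg : g ∈ G) : Equiv.swap (g x) (g y) = Equiv.swap x y := by
  have hconj : g * Equiv.swap x y * g⁻¹ = Equiv.swap (g x) (g y) := by
    rw [Equiv.mul_swap_eq_swap_mul, mul_inv_cancel_right]
  have h' : Equiv.swap (g x) (g y) ∉ G := by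
    rw [← hconj]
    intro hmem
    apply h
    simpa [mul_assoc] using mul_mem (mul_mem (inv_mem hg) hmem) hg
  have hsup := sup_zpowers_conj hg (Equiv.swap x y)
  rw [hconj] at hsup
  have heq := hG _ _ hsup ((inf_zpowers_swap h').trans (inf_zpowers_swap h).symm)
  have hmem := heq ▸ Subgroup.mem_zpowers (Equiv.swap (g x) (g y))
  rcases mem_zpowers_swap.1 hmem with h1 | h1
  · exact absurd (h1 ▸ one_mem G) h'
  · exact h1

/-- A cancellable element of the subgroup lattice of a finite symmetric group is trivial or the
whole group. -/
theorem IsCancellableElement.eq_top_of_mem [Finite α] {G : Subgroup (Equiv.Perm α)}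
    (hG : IsCancellableElement G) {g : Equiv.Perm α} (hg : g ∈ G) (hg1 : g ≠ 1) : G = ⊤ := by
  -- Since g centralizes (x y), it preserves the set {x, y}.
  have key : ∀ x y : α, Equiv.swap x y ∉ G → g x = x ∨ g x = y := by
    intro x y h
    have h1 := congrArg (fun σ : Equiv.Perm α => σ (g x)) (hG.swap_apply h hg)
    have hxy : x ≠ y := by
      rintro rfl
      exact h (Equiv.swap_self x ▸ one_mem G)
    by_contra! hne
    simp only [Equiv.swap_apply_left, Equiv.swap_apply_of_ne_of_ne hne.1 hne.2] at h1
    exact hxy (g.injective h1.symm)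
  obtain ⟨i, hi⟩ : ∃ i, g i ≠ i := by
    by_contra! hne
    exact hg1 (Equiv.ext hne)
  have hi_mem : ∀ k, k ≠ g i → Equiv.swap i k ∈ G := by
    intro k hk
    by_contra hmem
    exact (key i k hmem).elim hi fun h => hk h.symm
  -- Otherwise g exchanges i and g i. With no third point, g is that transposition. A third point m
  -- has (i m) ∈ G, so (g i, m) ∉ G by conjugation, and `key` contradicts g (g i) = i.
  have hgi : Equiv.swap i (g i) ∈ G := by
    by_contra hmem
    have hmem' : Equiv.swap (g i) i ∉ G := by rwa [Equiv.swap_comm]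
    have hback : g (g i) = i := (key _ _ hmem').resolve_left fun h => hi (g.injective h)
    have hthird : ∃ m, m ≠ i ∧ m ≠ g i := by
      by_contra! hne
      apply hmem
      suffices h : Equiv.swap i (g i) = g by rwa [h]
      ext k
      by_cases hk : k = i
      · rw [hk, Equiv.swap_apply_left]
      · rw [hne k hk, Equiv.swap_apply_right, hback]
    obtain ⟨m, hmi, hmg⟩ := hthird
    have hm : Equiv.swap (g i) m ∉ G := by
      intro hm
      apply hmem
      have h2 := mul_mem (mul_mem (hi_mem m hmg) hm) (hi_mem m hmg)
      have : Equiv.swap i m * Equiv.swap (g i) m * Equiv.swap i m = Equiv.swap i (g i) := by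
        rw [Equiv.mul_swap_eq_swap_mul (Equiv.swap i m), Equiv.swap_apply_right,
          Equiv.swap_apply_of_ne_of_ne hi (Ne.symm hmg), mul_assoc, Equiv.swap_mul_self, mul_one,
          Equiv.swap_comm]
      rwa [this] at h2
    rcases key _ _ hm with h | h
    · exact hi (g.injective h)
    · exact hmi (h.symm.trans hback)
  have hi_all : ∀ k, Equiv.swap i k ∈ G := fun k => by
    by_cases hk : k = g i
    · exact hk ▸ hgi
    · exact hi_mem k hk
  rw [eq_top_iff, ← Equiv.Perm.closure_isSwap, Subgroup.closure_le]
  rintro _ ⟨x, y, hxy, rfl⟩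
  by_contra hmem
  have hxy' : Equiv.swap x y = Equiv.swap i x * Equiv.swap i y * Equiv.swap i x ∨
      x = i ∨ y = i := by
    by_cases hx : x = i
    · exact Or.inr (Or.inl hx)
    by_cases hy : y = i
    · exact Or.inr (Or.inr hy)
    left
    rw [Equiv.mul_swap_eq_swap_mul (Equiv.swap i x), Equiv.swap_apply_left,
      Equiv.swap_apply_of_ne_of_ne hy (Ne.symm hxy), mul_assoc, Equiv.swap_mul_self, mul_one]
  rcases hxy' with h | rfl | rfl
  · exact hmem (h ▸ mul_mem (mul_mem (hi_all x) (hi_all y)) (hi_all x))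
  · exact hmem (hi_all y)
  · exact hmem (Equiv.swap_comm x y ▸ hi_all x)

end SymmetricGroup

/-! ### Words, linear words and substitutions -/

namespace SemigroupWord

theorem letters_injective : Function.Injective letters := by
  rintro ⟨a, l⟩ ⟨b, m⟩ h
  simp only [letters, List.cons.injEq] at h
  exact FreeSemigroup.ext h.1 h.2

theorem letters_ne_nil (w : SemigroupWord) : w.letters ≠ [] := List.cons_ne_nil _ _

theorem exists_letters_eq {l : List ℕ} (hl : l ≠ []) : ∃ w : SemigroupWord, w.letters = l := by
  cases l with
  | nil => exact absurd rfl hl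
  | cons a l => exact ⟨⟨a, l⟩, rfl⟩

@[simp]
theorem letters_of (x : ℕ) : letters (FreeSemigroup.of x) = [x] := rfl

@[simp]
theorem letters_mul (u v : SemigroupWord) : letters (u * v) = u.letters ++ v.letters := rfl

theorem letters_lift (f : ℕ → SemigroupWord) (u : SemigroupWord) :
    letters (FreeSemigroup.lift f u) = u.letters.flatMap fun x => (f x).letters := by
  induction u using FreeSemigroup.recOnMul with
  | ih1 x => simp
  | ih2 x y hx hy => simp only [map_mul, letters_mul, List.flatMap_append, hx, hy]

theorem letters_map (c : ℕ → ℕ) (u : SemigroupWord) :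
    letters (FreeSemigroup.map c u) = u.letters.map c := by
  induction u using FreeSemigroup.recOnMul with
  | ih1 x => simp
  | ih2 x y hx hy => simp only [map_mul, letters_mul, List.map_append, hx, hy]

theorem lift_map {S : Type*} [Semigroup S] (f : ℕ → S) (c : ℕ → ℕ) (u : SemigroupWord) :
    FreeSemigroup.lift f (FreeSemigroup.map c u) = FreeSemigroup.lift (f ∘ c) u := by
  induction u using FreeSemigroup.recOnMul with
  | ih1 x => simp
  | ih2 x y hx hy => simp only [map_mul, hx, hy]

theorem lift_eq_of_letters {S : Type*} [Semigroup S] (f : ℕ → S) (c : ℕ → ℕ)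
    {u v : SemigroupWord} (h : v.letters = u.letters.map c) :
    FreeSemigroup.lift f v = FreeSemigroup.lift (f ∘ c) u := by
  rw [← lift_map, letters_injective (h.trans (letters_map c u).symm)]

/-- Words of length `n` without repeated letters. -/
def IsLinear (n : ℕ) (w : SemigroupWord) : Prop := w.letters.length = n ∧ w.letters.Nodup

/-- Words of length at least `n` that are not linear words of length `n`. -/
def IsLong (n : ℕ) (w : SemigroupWord) : Prop := n ≤ w.letters.length ∧ ¬ IsLinear n w

theorem isLinear_of_letters_eq_ofFn {n : ℕ} {a : Fin n → ℕ} (ha : Function.Injective a)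
    {w : SemigroupWord} (h : w.letters = List.ofFn a) : IsLinear n w := by
  simp [IsLinear, h, List.nodup_ofFn.2 ha]

theorem isLong_of_lt {n : ℕ} {w : SemigroupWord} (h : n < w.letters.length) : IsLong n w :=
  ⟨h.le, fun h' => h.ne' h'.1⟩

theorem length_le_length_flatMap (f : ℕ → SemigroupWord) (l : List ℕ) :
    l.length ≤ (l.flatMap fun x => (f x).letters).length := by
  induction l with
  | nil => simp
  | cons a l ih =>
    simp only [List.flatMap_cons, List.length_append, List.length_cons]
    have : 0 < (f a).letters.length := List.length_pos_iff.2 (letters_ne_nil _)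
    omega

theorem letters_eq_of_length_flatMap_le (f : ℕ → SemigroupWord) (l : List ℕ)
    (h : (l.flatMap fun x => (f x).letters).length ≤ l.length) :
    ∀ x ∈ l, (f x).letters = [(f x).head] := by
  induction l with
  | nil => simp
  | cons a l ih =>
    simp only [List.flatMap_cons, List.length_append, List.length_cons] at h
    have h0 : 0 < (f a).letters.length := List.length_pos_iff.2 (letters_ne_nil _)
    have h1 := length_le_length_flatMap f l
    intro x hx
    rcases List.mem_cons.1 hx with rfl | hx
    · have h2 : (f x).letters.length = 1 := by omega
      simpa [letters] using h2
    · exact ih (by omega) x hx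

theorem letters_lift_eq_map (f : ℕ → SemigroupWord) (u : SemigroupWord)
    (h : ∀ x ∈ u.letters, (f x).letters = [(f x).head]) :
    letters (FreeSemigroup.lift f u) = u.letters.map fun x => (f x).head := by
  rw [letters_lift, List.flatMap_congr h]
  exact List.map_eq_flatMap.symm

theorem length_le_length_lift (f : ℕ → SemigroupWord) (u : SemigroupWord) :
    u.letters.length ≤ (letters (FreeSemigroup.lift f u)).length := by
  rw [letters_lift]
  exact length_le_length_flatMap f _

theorem letters_eq_of_isLinear_lift {n : ℕ} {f : ℕ → SemigroupWord} {u : SemigroupWord}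
    (hu : n ≤ u.letters.length) (h : IsLinear n (FreeSemigroup.lift f u)) :
    ∀ x ∈ u.letters, (f x).letters = [(f x).head] := by
  apply letters_eq_of_length_flatMap_le
  rw [← letters_lift, h.1]
  exact hu

/-- Substitution never shortens a word, so a linear image of length n means letters were replaced by
distinct letters, and u was already linear. -/
theorem IsLong.lift {n : ℕ} {u : SemigroupWord} (hu : IsLong n u) (f : ℕ → SemigroupWord) :
    IsLong n (FreeSemigroup.lift f u) := by
  refine ⟨hu.1.trans (length_le_length_lift f u), fun h => hu.2 ?_⟩
  have h1 := letters_lift_eq_map f u (letters_eq_of_isLinear_lift hu.1 h)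
  obtain ⟨h2, h3⟩ := h
  rw [h1] at h2 h3
  exact ⟨by simpa using h2, h3.of_map _⟩

end SemigroupWord

/-! ### The fully invariant congruence of a permutation group -/

open SemigroupWord

/-- The relation on words that identifies all long words and identifies linear words of length `n`
that differ by a permutation of positions from `H`. -/
def PermRel {n : ℕ} (H : Subgroup (Equiv.Perm (Fin n))) (u v : SemigroupWord) : Prop :=
  u = v ∨ (IsLong n u ∧ IsLong n v) ∨
    ∃ a : Fin n → ℕ, Function.Injective a ∧ ∃ π ∈ H,
      u.letters = List.ofFn a ∧ v.letters = List.ofFn (a ∘ π)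

namespace PermRel

variable {n : ℕ} {H : Subgroup (Equiv.Perm (Fin n))} {u v w : SemigroupWord}

theorem symm (h : PermRel H u v) : PermRel H v u := by
  rcases h with rfl | ⟨h1, h2⟩ | ⟨a, ha, π, hπ, h1, h2⟩
  · exact Or.inl rfl
  · exact Or.inr (Or.inl ⟨h2, h1⟩)
  · refine Or.inr (Or.inr ⟨a ∘ π, ha.comp π.injective, π⁻¹, inv_mem hπ, h2, ?_⟩)
    rw [h1]
    congr 1
    ext i
    simp

theorem trans (h : PermRel H u v) (h' : PermRel H v w) : PermRel H u w := by
  rcases h with rfl | ⟨h1, h2⟩ | ⟨a, ha, π, hπ, h1, h2⟩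
  · exact h'
  · rcases h' with rfl | ⟨h3, h4⟩ | ⟨b, hb, σ, hσ, h3, h4⟩
    · exact Or.inr (Or.inl ⟨h1, h2⟩)
    · exact Or.inr (Or.inl ⟨h1, h4⟩)
    · exact absurd (isLinear_of_letters_eq_ofFn hb h3) h2.2
  · rcases h' with rfl | ⟨h3, h4⟩ | ⟨b, hb, σ, hσ, h3, h4⟩
    · exact Or.inr (Or.inr ⟨a, ha, π, hπ, h1, h2⟩)
    · exact absurd (isLinear_of_letters_eq_ofFn (ha.comp π.injective) h2) h3.2
    · have hb' : b = a ∘ π := List.ofFn_injective (h3.symm.trans h2)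
      refine Or.inr (Or.inr ⟨a, ha, π * σ, mul_mem hπ hσ, h1, ?_⟩)
      rw [h4, hb']
      rfl

theorem eq_or_length (h : PermRel H u v) :
    u = v ∨ n ≤ u.letters.length ∧ n ≤ v.letters.length := by
  rcases h with rfl | ⟨h1, h2⟩ | ⟨a, ha, π, hπ, h1, h2⟩
  · exact Or.inl rfl
  · exact Or.inr ⟨h1.1, h2.1⟩
  · right
    simp [h1, h2]

/-- Distinct related words have length at least n; a further nonempty factor makes both products
long. -/
theorem mul {u' v' : SemigroupWord} (h : PermRel H u v) (h' : PermRel H u' v') :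
    PermRel H (u * u') (v * v') := by
  have pos : ∀ w : SemigroupWord, 0 < w.letters.length := fun w =>
    List.length_pos_iff.2 (letters_ne_nil w)
  have := pos u
  have := pos v
  have := pos u'
  have := pos v'
  rcases h.eq_or_length with rfl | h
  · rcases h'.eq_or_length with rfl | h'
    · exact Or.inl rfl
    · refine Or.inr (Or.inl ⟨isLong_of_lt ?_, isLong_of_lt ?_⟩) <;>
        rw [letters_mul, List.length_append] <;> omega
  · refine Or.inr (Or.inl ⟨isLong_of_lt ?_, isLong_of_lt ?_⟩) <;>
      rw [letters_mul, List.length_append] <;> omega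

theorem lift_of_isLinear {a : Fin n → ℕ} {π : Equiv.Perm (Fin n)} (hπ : π ∈ H)
    (hu : u.letters = List.ofFn a) (hv : v.letters = List.ofFn (a ∘ π)) {f : ℕ → SemigroupWord}
    (h : IsLinear n (FreeSemigroup.lift f u)) :
    PermRel H (FreeSemigroup.lift f u) (FreeSemigroup.lift f v) := by
  have h1 := letters_eq_of_isLinear_lift (by simp [hu]) h
  have h2 : ∀ x ∈ v.letters, (f x).letters = [(f x).head] := by
    intro x hx
    apply h1
    rw [hv, List.mem_ofFn] at hx
    obtain ⟨i, rfl⟩ := hx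
    rw [hu, List.mem_ofFn]
    exact ⟨π i, rfl⟩
  have h3 := letters_lift_eq_map f u h1
  have h4 := letters_lift_eq_map f v h2
  rw [hu, List.map_ofFn] at h3
  rw [hv, List.map_ofFn] at h4
  refine Or.inr (Or.inr ⟨_, ?_, π, hπ, h3, h4⟩)
  rw [← List.nodup_ofFn, ← h3]
  exact h.2

theorem lift (h : PermRel H u v) (f : ℕ → SemigroupWord) :
    PermRel H (FreeSemigroup.lift f u) (FreeSemigroup.lift f v) := by
  rcases h with rfl | ⟨h1, h2⟩ | ⟨a, ha, π, hπ, h1, h2⟩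
  · exact Or.inl rfl
  · exact Or.inr (Or.inl ⟨h1.lift f, h2.lift f⟩)
  · by_cases hu : IsLinear n (FreeSemigroup.lift f u)
    · exact lift_of_isLinear hπ h1 h2 hu
    by_cases hv : IsLinear n (FreeSemigroup.lift f v)
    · refine (lift_of_isLinear (inv_mem hπ) h2 ?_ hv).symm
      rw [h1]
      congr 1
      ext i
      simp
    · refine Or.inr (Or.inl ⟨⟨?_, hu⟩, ⟨?_, hv⟩⟩)
      · exact le_trans (by simp [h1]) (length_le_length_lift f u)
      · exact le_trans (by simp [h2]) (length_le_length_lift f v)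

/-- The fully invariant congruence `PermRel H`. -/
def con (H : Subgroup (Equiv.Perm (Fin n))) : Con SemigroupWord where
  r := PermRel H
  iseqv := ⟨fun _ => Or.inl rfl, symm, trans⟩
  mul' := mul

/-- The canonical homomorphism onto the relatively free semigroup of `PermRel H`. -/
def toQuotient (H : Subgroup (Equiv.Perm (Fin n))) :
    SemigroupWord →ₙ* ULift.{u} (con H).Quotient where
  toFun w := ⟨(w : (con H).Quotient)⟩
  map_mul' _ _ := rfl

theorem toQuotient_eq_iff : toQuotient.{u} H u = toQuotient.{u} H v ↔ PermRel H u v := by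
  refine ULift.up_injective.eq_iff.trans ?_
  exact (con H).eq

theorem toQuotient_surjective : Function.Surjective (toQuotient.{u} H) := by
  rintro ⟨x⟩
  obtain ⟨w, rfl⟩ := Quotient.exists_rep x
  exact ⟨w, rfl⟩

theorem lift_toQuotient (f : ℕ → SemigroupWord) (w : SemigroupWord) :
    FreeSemigroup.lift (fun x => toQuotient.{u} H (f x)) w =
      toQuotient.{u} H (FreeSemigroup.lift f w) := by
  induction w using FreeSemigroup.recOnMul with
  | ih1 x => simp
  | ih2 x y hx hy => simp only [map_mul, hx, hy]

theorem holdsIn_quotient_iff {e : SemigroupIdentity} :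
    e.HoldsIn (ULift.{u} (con H).Quotient) ↔ PermRel H e.lhs e.rhs := by
  constructor
  · intro h
    have h1 := h fun x => toQuotient.{u} H (FreeSemigroup.of x)
    have h2 : ∀ w : SemigroupWord, FreeSemigroup.lift FreeSemigroup.of w = w := fun w => by
      induction w using FreeSemigroup.recOnMul with
      | ih1 x => simp
      | ih2 x y hx hy => simp only [map_mul, hx, hy]
    rwa [lift_toQuotient, lift_toQuotient, h2, h2, toQuotient_eq_iff] at h1
  · intro h f
    choose g hg using fun x => toQuotient_surjective.{u} (H := H) (f x)
    obtain rfl : (fun x => toQuotient.{u} H (g x)) = f := funext hg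
    rw [lift_toQuotient, lift_toQuotient, toQuotient_eq_iff]
    exact h.lift g

end PermRel

/-- The permutations `π` such that `S` satisfies the identity `x₁ ⋯ xₙ ≈ x_{π(1)} ⋯ x_{π(n)}`. -/
def permGroup (n : ℕ) (S : Type u) [Semigroup S] : Subgroup (Equiv.Perm (Fin n)) where
  -- Allowing arbitrary letters `a` gives closure under products by chaining through `a ∘ π`.
  carrier := {π | ∀ (a : Fin n → ℕ) (e : SemigroupIdentity), e.lhs.letters = List.ofFn a →
    e.rhs.letters = List.ofFn (a ∘ π) → e.HoldsIn S}
  one_mem' := by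
    intro a e h1 h2 f
    rw [letters_injective (h1.trans h2.symm)]
  mul_mem' := by
    intro π σ hπ hσ a e h1 h2 f
    have hne : List.ofFn (a ∘ π) ≠ [] := by
      have := letters_ne_nil e.lhs
      rw [h1] at this
      simpa using this
    obtain ⟨w, hw⟩ := exists_letters_eq hne
    exact (hπ a ⟨e.lhs, w⟩ h1 hw f).trans (hσ (a ∘ π) ⟨w, e.rhs⟩ hw h2 f)
  inv_mem' := by
    intro π hπ a e h1 h2 f
    refine (hπ (a ∘ ⇑π⁻¹) ⟨e.rhs, e.lhs⟩ h2 ?_ f).symm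
    rw [h1]
    congr 1
    ext i
    simp

theorem mem_permGroup_of_holdsIn {n : ℕ} {S : Type u} [Semigroup S] {e : SemigroupIdentity}
    {a : Fin n → ℕ} (ha : Function.Injective a) {π : Equiv.Perm (Fin n)}
    (h1 : e.lhs.letters = List.ofFn a) (h2 : e.rhs.letters = List.ofFn (a ∘ π))
    (he : e.HoldsIn S) : π ∈ permGroup n S := by
  intro b e' h3 h4 f
  -- Rename each letter `a i` to `b i`; the default `id` off the range of `a` plays no role.
  have hc : ∀ i, Function.extend a b id (a i) = b i := ha.extend_apply b id
  rw [lift_eq_of_letters f (Function.extend a b id) (u := e.lhs),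
    lift_eq_of_letters f (Function.extend a b id) (u := e.rhs)]
  · exact he _
  · rw [h4, h2, List.map_ofFn]
    congr 1
    ext i
    exact (hc (π i)).symm
  · rw [h3, h1, List.map_ofFn]
    congr 1
    ext i
    exact (hc i).symm

/-! ### Transfer of cancellability from varieties to subgroups -/

namespace SemigroupVariety

/-- The permutations defining permutational identities of length `n` satisfied by `V`. -/
def permGroup (V : SemigroupVariety.{u}) (n : ℕ) : Subgroup (Equiv.Perm (Fin n)) :=
  ⨅ S ∈ V.carrier, _root_.permGroup n S

theorem mem_permGroup {V : SemigroupVariety.{u}} {n : ℕ} {π : Equiv.Perm (Fin n)} :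
    π ∈ V.permGroup n ↔ ∀ S ∈ V.carrier, π ∈ _root_.permGroup n S := by
  simp [permGroup, Subgroup.mem_iInf]

/-- The variety whose identities are the pairs in `PermRel H`. -/
def ofPermGroup {n : ℕ} (H : Subgroup (Equiv.Perm (Fin n))) : SemigroupVariety.{u} :=
  ofIdentities {e | PermRel H e.lhs e.rhs}

variable {n : ℕ} {H K : Subgroup (Equiv.Perm (Fin n))} {V : SemigroupVariety.{u}}

theorem ofPermGroup_satisfies_iff {e : SemigroupIdentity} :
    (ofPermGroup.{u} H).Satisfies e ↔ PermRel H e.lhs e.rhs := by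
  constructor
  · intro h
    refine PermRel.holdsIn_quotient_iff.{u}.1
      (h (Semigrp.of (ULift.{u} (PermRel.con H).Quotient)) ⟨?_, ?_⟩)
    · exact ⟨PermRel.toQuotient H (FreeSemigroup.of 0)⟩
    · exact fun e he => PermRel.holdsIn_quotient_iff.2 he
  · exact fun h S hS => hS.2 e h

theorem le_permGroup_of_mem {S : Semigrp.{u}} (hS : S ∈ (ofPermGroup.{u} H).carrier) (hn : 0 < n) :
    H ≤ _root_.permGroup n S := by
  intro π hπ
  obtain ⟨u, hu⟩ := exists_letters_eq (l := List.ofFn (Fin.val : Fin n → ℕ))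
    (by simpa using hn.ne')
  obtain ⟨v, hv⟩ := exists_letters_eq (l := List.ofFn ((Fin.val : Fin n → ℕ) ∘ π))
    (by simpa using hn.ne')
  exact mem_permGroup_of_holdsIn (e := ⟨u, v⟩) Fin.val_injective hu hv
    (hS.2 _ (Or.inr (Or.inr ⟨_, Fin.val_injective, π, hπ, hu, hv⟩)))

/-- The permutations valid in a member of the left side form a group containing `V.permGroup n` and
H, hence K. -/
theorem inf_ofPermGroup_le (hn : 0 < n) (h : V.permGroup n ⊔ H = V.permGroup n ⊔ K) :
    V ⊓ ofPermGroup H ≤ V ⊓ ofPermGroup K := by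
  rintro S ⟨hV, hS⟩
  refine ⟨hV, hS.1, ?_⟩
  have hK : K ≤ _root_.permGroup n S := by
    refine (le_sup_right.trans h.ge).trans (sup_le ?_ (le_permGroup_of_mem hS hn))
    exact fun π hπ => mem_permGroup.1 hπ S hV
  rintro e (he | he | ⟨a, -, π, hπ, h1, h2⟩)
  · exact hS.2 e (Or.inl he)
  · exact hS.2 e (Or.inr (Or.inl he))
  · exact hK hπ a e h1 h2

/-- Only identities between linear words depend on the subgroup; one shared with V has its
permutation in the intersection. -/
theorem sup_ofPermGroup_le (h : V.permGroup n ⊓ H = V.permGroup n ⊓ K) :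
    V ⊔ ofPermGroup H ≤ V ⊔ ofPermGroup K := by
  rintro S ⟨hS, hS'⟩
  refine ⟨hS, fun e he => hS' e ⟨he.1, ?_⟩⟩
  obtain ⟨heV, heK⟩ := he
  rw [ofPermGroup_satisfies_iff] at heK ⊢
  rcases heK with he | he | ⟨a, ha, π, hπ, h1, h2⟩
  · exact Or.inl he
  · exact Or.inr (Or.inl he)
  · have hπV : π ∈ V.permGroup n :=
      mem_permGroup.2 fun T hT => mem_permGroup_of_holdsIn ha h1 h2 (heV T hT)
    have hπH : π ∈ V.permGroup n ⊓ H := h ▸ ⟨hπV, hπ⟩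
    exact Or.inr (Or.inr ⟨a, ha, π, hπH.2, h1, h2⟩)

theorem le_of_ofPermGroup_eq (hn : 0 < n) (h : ofPermGroup.{u} H = ofPermGroup K) : H ≤ K := by
  intro π hπ
  obtain ⟨u, hu⟩ := exists_letters_eq (l := List.ofFn (Fin.val : Fin n → ℕ))
    (by simpa using hn.ne')
  obtain ⟨v, hv⟩ := exists_letters_eq (l := List.ofFn ((Fin.val : Fin n → ℕ) ∘ π))
    (by simpa using hn.ne')
  have hH : (ofPermGroup.{u} H).Satisfies ⟨u, v⟩ :=
    ofPermGroup_satisfies_iff.2 (Or.inr (Or.inr ⟨_, Fin.val_injective, π, hπ, hu, hv⟩))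
  rw [h, ofPermGroup_satisfies_iff] at hH
  rcases hH with he | he | ⟨a, ha, σ, hσ, h1, h2⟩
  · have hval : (Fin.val : Fin n → ℕ) = Fin.val ∘ π :=
      List.ofFn_injective (hu.symm.trans ((congrArg letters he).trans hv))
    have : π = 1 := Equiv.ext fun i => Fin.val_injective (congrFun hval i).symm
    exact this ▸ one_mem K
  · exact absurd (isLinear_of_letters_eq_ofFn Fin.val_injective hu) he.1.2
  · obtain rfl : Fin.val = a := List.ofFn_injective (hu.symm.trans h1)
    have hval := List.ofFn_injective (hv.symm.trans h2)
    have : π = σ := Equiv.ext fun i => Fin.val_injective (congrFun hval i)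
    exact this ▸ hσ

/-- For a cancellable variety, the group of its permutational identities of length `n` is a
cancellable element of the subgroup lattice of the symmetric group. -/
theorem isCancellableElement_permGroup (hV : IsCancellableElement V) (hn : 0 < n) :
    IsCancellableElement (V.permGroup n) := by
  intro H K hsup hinf
  have h : ofPermGroup.{u} H = ofPermGroup K := hV _ _
    (le_antisymm (sup_ofPermGroup_le hinf) (sup_ofPermGroup_le hinf.symm))
    (le_antisymm (inf_ofPermGroup_le hn hsup) (inf_ofPermGroup_le hn hsup.symm))
  exact le_antisymm (le_of_ofPermGroup_eq hn h) (le_of_ofPermGroup_eq hn h.symm)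

end SemigroupVariety

theorem proposition3p3 (V : SemigroupVariety.{u}) (hV : IsCancellableElement V) (n : ℕ)
    (h : ∃ e : SemigroupIdentity, IsPermutationalIdentity n e ∧ V.Satisfies e) :
    ∀ e : SemigroupIdentity, IsPermutationalIdentity n e → V.Satisfies e := by
  obtain ⟨e, ⟨π, hπ, h1, h2⟩, he⟩ := h
  have hn : 0 < n := by
    rcases Nat.eq_zero_or_pos n with rfl | hn
    · exact absurd (Subsingleton.elim π 1) hπ
    · exact hn
  have hmem : π ∈ V.permGroup n := SemigroupVariety.mem_permGroup.2 fun S hS =>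
    mem_permGroup_of_holdsIn Fin.val_injective h1 h2 (he S hS)
  have htop := (SemigroupVariety.isCancellableElement_permGroup hV hn).eq_top_of_mem hmem hπ
  rintro e' ⟨σ, -, h3, h4⟩ S hS
  have hσ : σ ∈ V.permGroup n := htop ▸ Subgroup.mem_top σ
  exact SemigroupVariety.mem_permGroup.1 hσ S hS _ e' h3 h4
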